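/- Let $a\ge 3$ be an integer, and let $\mathfrak g$ be the complex Kac--Moody algebra with Cartan matrix $\begin{pmatrix}2&-a\\-a&2\end{pmatrix}$, Chevalley generators $e_p,f_p,h_p$ ($p=0,1$), Cartan subalgebra $\mathfrak h=\mathbb C h_0+\mathbb C h_1$ and simple roots $\alpha_0,\alpha_1$. Let $\omega_0$ be the compact involution, i.e. the antilinear automorphism of $\mathfrak g$ with $\omega_0(e_p)=-f_p$, $\omega_0(f_p)=-e_p$, $\omega_0(h_p)=-h_p$. We write $(s,t)$ for $s\alpha_0+t\alpha_1$. A root is called real if it is conjugate to a simple root under the Weyl group, and imaginary otherwise. Put $F_0=0$, $F_1=1$, $F_{r+2}=aF_{r+1}-F_r$. Let $i,j\ge 0$ be integers and put $(k,l)=(F_{i+1},F_i)$ and $(m,n)=(F_j,F_{j+1})$. Let $E_0$ and $E_1$ be non-zero root vectors for the roots $(k,l)$ and $(m,n)$, let $c_0,c_1$ be non-zero complex numbers, and put $X=c_0E_0+c_1E_1$. Suppose that $X$, $Y=\omega_0(X)$ and $H=[X,Y]$ form an $\mathfrak{sl}_2$-triple ($H\ne0$, $[H,X]=2X$, $[H,Y]=-2Y$),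 and that $H$ is dominant, i.e. $H\in\mathbb R h_0+\mathbb R h_1$ and $\alpha_0(H),\alpha_1(H)\ge 0$. (It is known that then $i\in\{j-1,j,j+1\}$.) Let $f(x,y)=x^2-axy+y^2$ and $R=\{(x,y)\in\mathbb R^2: f(x,y)\le 1\}$. Let $L$ be the set of $(x,y)\in\mathbb R^2\setminus\{(0,0)\}$ with $x\ge0$, $y\ge0$, $f(x,y)\le 1$ and $$x<F_{i+1}\ \text{ if } i=j-1,\qquad x+y<F_{i+1}+F_i\ \text{ if } i=j,\qquad y<F_i\ \text{ if } i=j+1 .$$ A root $(s,t)$ is said to be * of type A if $(s-k,t-l)\notin R$ and $(s-m,t-n)\notin R$; * of type B if $(s-k,t-l)\in R$ and $(s+k,t+l)\notin R$, or $(s-m,t-n)\in R$ and $(s+m,t+n)\notin R$; * of type C if $(s-k,t-l)\in R$ and $(s+k,t+l)\in R$, or $(s-m,t-n)\in R$ and $(s+m,t+n)\in R$. **Theorem.** 1. Every real root in $L$ is of type B. 2. Every imaginary root (in $L$ or not) that can be written as $(k-s,l-t)$ or $(m-s,n-t)$ with $(s,t)$ a real root is of type C. 3. Every other imaginary root in $L$,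 i.e. every imaginary root in $L$ that cannot be written in this way, is of type A. -/

import Mathlib

noncomputable section

namespace KacMoodyRankTwo

open CartanMatrix

/-! ### The rank two Kac–Moody algebra -/

/-- The generalized Cartan matrix `(2, -a; -a, 2)`. -/
def gcm (a : ℤ) : Matrix (Fin 2) (Fin 2) ℤ := !![2, -a; -a, 2]

/-- The complex Kac–Moody algebra of the Cartan matrix `(2, -a; -a, 2)`, presented by Chevalley
generators and Serre relations. For `a ≥ 3` the matrix is symmetric and invertible, so that this is
the whole Kac–Moody algebra, with Cartan subalgebra spanned by `h₀, h₁`. -/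
abbrev KM (a : ℤ) : Type := Matrix.ToLieAlgebra ℂ (gcm a)

/-- The quotient map from the free Lie algebra on the Chevalley generators. -/
def proj (a : ℤ) : FreeLieAlgebra ℂ (Generators (Fin 2)) →ₗ[ℂ] KM a :=
  (Relations.toIdeal ℂ (gcm a)).toSubmodule.mkQ

theorem proj_lie (a : ℤ) (x y : FreeLieAlgebra ℂ (Generators (Fin 2))) :
    proj a ⁅x, y⁆ = ⁅proj a x, proj a y⁆ := rfl

theorem proj_surjective (a : ℤ) : Function.Surjective (proj a) :=
  Submodule.mkQ_surjective _

theorem proj_eq_zero (a : ℤ) {x : FreeLieAlgebra ℂ (Generators (Fin 2))}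
    (hx : x ∈ Relations.toSet ℂ (gcm a)) : proj a x = 0 :=
  (Submodule.Quotient.mk_eq_zero _).2 (LieSubmodule.subset_lieSpan hx)

/-- The Chevalley generators `h₀, h₁`. -/
def h (a : ℤ) (p : Fin 2) : KM a := proj a (FreeLieAlgebra.of ℂ (Generators.H p))

/-- The Chevalley generators `e₀, e₁`. -/
def e (a : ℤ) (p : Fin 2) : KM a := proj a (FreeLieAlgebra.of ℂ (Generators.E p))

/-- The Chevalley generators `f₀, f₁`. -/
def f (a : ℤ) (p : Fin 2) : KM a := proj a (FreeLieAlgebra.of ℂ (Generators.F p))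

theorem lie_h_h (a : ℤ) (p q : Fin 2) : ⁅h a p, h a q⁆ = 0 :=
  proj_eq_zero a (x := Relations.HH ℂ (p, q)) (by simp [Relations.toSet])

theorem lie_e_f_self (a : ℤ) (p : Fin 2) : ⁅e a p, f a p⁆ = h a p := by
  have := proj_eq_zero a (x := Relations.EF ℂ (p, p)) (by simp [Relations.toSet])
  simp only [Relations.EF, Function.uncurry, if_true, map_sub] at this
  exact sub_eq_zero.1 this

theorem lie_e_f_of_ne (a : ℤ) {p q : Fin 2} (hpq : p ≠ q) : ⁅e a p, f a q⁆ = 0 := by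
  have := proj_eq_zero a (x := Relations.EF ℂ (p, q)) (by simp [Relations.toSet])
  simp only [Relations.EF, Function.uncurry, if_neg hpq] at this
  exact this

theorem lie_h_e (a : ℤ) (p q : Fin 2) : ⁅h a p, e a q⁆ = gcm a p q • e a q := by
  have := proj_eq_zero a (x := Relations.HE ℂ (gcm a) (p, q)) (by simp [Relations.toSet])
  simp only [Relations.HE, Function.uncurry, map_sub, map_zsmul] at this
  exact sub_eq_zero.1 this

theorem lie_h_f (a : ℤ) (p q : Fin 2) : ⁅h a p, f a q⁆ = -(gcm a p q • f a q) := by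
  have := proj_eq_zero a (x := Relations.HF ℂ (gcm a) (p, q)) (by simp [Relations.toSet])
  simp only [Relations.HF, Function.uncurry, map_add, map_zsmul] at this
  exact eq_neg_of_add_eq_zero_left this

theorem proj_ad_pow (a : ℤ) (n : ℕ) (x y : FreeLieAlgebra ℂ (Generators (Fin 2))) :
    proj a (((LieAlgebra.ad ℂ _ x) ^ n) y) = ((LieAlgebra.ad ℂ (KM a) (proj a x)) ^ n) (proj a y) := by
  induction n with
  | zero => rfl
  | succ n ih => rw [pow_succ', pow_succ', Module.End.mul_apply, Module.End.mul_apply, ← ih]; rfl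

theorem ad_e_pow (a : ℤ) (p q : Fin 2) :
    ((LieAlgebra.ad ℂ (KM a) (e a p)) ^ (-gcm a p q).toNat) ⁅e a p, e a q⁆ = 0 := by
  have := proj_eq_zero a (x := Relations.adE ℂ (gcm a) (p, q)) (by simp [Relations.toSet])
  simp only [Relations.adE, Function.uncurry, proj_ad_pow] at this
  exact this

theorem ad_f_pow (a : ℤ) (p q : Fin 2) :
    ((LieAlgebra.ad ℂ (KM a) (f a p)) ^ (-gcm a p q).toNat) ⁅f a p, f a q⁆ = 0 := by
  have := proj_eq_zero a (x := Relations.adF ℂ (gcm a) (p, q)) (by simp [Relations.toSet])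
  simp only [Relations.adF, Function.uncurry, proj_ad_pow] at this
  exact this

/-! ### The compact involution -/

/-- The complex conjugate of a complex Lie algebra: the same Lie ring, on which `z` acts as the
conjugate of `z` does on the original one. -/
def ConjLie (L : Type) : Type := L

instance (L : Type) [LieRing L] : LieRing (ConjLie L) := inferInstanceAs (LieRing L)

instance (L : Type) [LieRing L] [LieAlgebra ℂ L] : Module ℂ (ConjLie L) :=
  Module.compHom L (starRingEnd ℂ)

instance (L : Type) [LieRing L] [LieAlgebra ℂ L] : LieAlgebra ℂ (ConjLie L) where
  lie_smul z x y := LieAlgebra.lie_smul (R := ℂ) (L := L) (starRingEnd ℂ z) x y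

/-- The values of the compact involution on the generators. -/
def compactInvolutionGen (a : ℤ) : Generators (Fin 2) → ConjLie (KM a)
  | .H p => (-h a p : KM a)
  | .E p => (-f a p : KM a)
  | .F p => (-e a p : KM a)

/-- The compact involution, before passing to the quotient by the Serre relations. -/
def compactInvolutionFree (a : ℤ) :
    FreeLieAlgebra ℂ (Generators (Fin 2)) →ₗ⁅ℂ⁆ ConjLie (KM a) :=
  FreeLieAlgebra.lift ℂ (compactInvolutionGen a)

theorem compactInvolutionFree_H (a : ℤ) (p : Fin 2) :
    compactInvolutionFree a (FreeLieAlgebra.of ℂ (Generators.H p)) = (-h a p : KM a) :=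
  FreeLieAlgebra.lift_of_apply _ _

theorem compactInvolutionFree_E (a : ℤ) (p : Fin 2) :
    compactInvolutionFree a (FreeLieAlgebra.of ℂ (Generators.E p)) = (-f a p : KM a) :=
  FreeLieAlgebra.lift_of_apply _ _

theorem compactInvolutionFree_F (a : ℤ) (p : Fin 2) :
    compactInvolutionFree a (FreeLieAlgebra.of ℂ (Generators.F p)) = (-e a p : KM a) :=
  FreeLieAlgebra.lift_of_apply _ _

theorem compactInvolutionFree_ad_pow (a : ℤ) (n : ℕ)
    (x y : FreeLieAlgebra ℂ (Generators (Fin 2))) (x' y' : KM a)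
    (hx : compactInvolutionFree a x = (-x' : KM a)) (hy : compactInvolutionFree a y = y') :
    compactInvolutionFree a (((LieAlgebra.ad ℂ _ x) ^ n) y) =
      ((-1) ^ n • ((LieAlgebra.ad ℂ (KM a) x') ^ n) y' : KM a) := by
  induction n with
  | zero => simpa using hy
  | succ n ih =>
    rw [pow_succ', Module.End.mul_apply, LieAlgebra.ad_apply, LieHom.map_lie, ih, hx,
      pow_succ' (LieAlgebra.ad ℂ (KM a) x'), Module.End.mul_apply, LieAlgebra.ad_apply]
    change ⁅(-x' : KM a), ((-1 : ℤ) ^ n • ((LieAlgebra.ad ℂ (KM a) x') ^ n) y' : KM a)⁆ = _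
    rw [neg_lie, lie_zsmul, pow_succ', neg_one_mul, neg_smul]

theorem compactInvolutionFree_toSet (a : ℤ) {x : FreeLieAlgebra ℂ (Generators (Fin 2))}
    (hx : x ∈ Relations.toSet ℂ (gcm a)) : compactInvolutionFree a x = 0 := by
  simp only [Relations.toSet, Set.mem_union, Set.mem_range, Prod.exists] at hx
  rcases hx with ((((⟨p, q, rfl⟩ | ⟨p, q, rfl⟩) | ⟨p, q, rfl⟩) | ⟨p, q, rfl⟩) | ⟨p, q, rfl⟩) |
    ⟨p, q, rfl⟩
  · simp only [Relations.HH, Function.uncurry, Function.comp_apply, LieHom.map_lie,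
      compactInvolutionFree_H]
    change ⁅(-h a p : KM a), (-h a q : KM a)⁆ = 0
    rw [neg_lie, lie_neg, lie_h_h, neg_zero, neg_zero]
  · by_cases hpq : p = q
    · subst hpq
      simp only [Relations.EF, Function.uncurry, Function.comp_apply, if_true, map_sub,
        LieHom.map_lie, compactInvolutionFree_H, compactInvolutionFree_E, compactInvolutionFree_F]
      change ⁅(-f a p : KM a), (-e a p : KM a)⁆ - (-h a p : KM a) = 0
      rw [neg_lie, lie_neg, ← lie_skew, lie_e_f_self]
      abel
    · simp only [Relations.EF, Function.uncurry, Function.comp_apply, if_neg hpq,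
        LieHom.map_lie, compactInvolutionFree_E, compactInvolutionFree_F]
      change ⁅(-f a p : KM a), (-e a q : KM a)⁆ = 0
      rw [neg_lie, lie_neg, ← lie_skew, lie_e_f_of_ne a (Ne.symm hpq)]
      simp
  · simp only [Relations.HE, Function.uncurry, Function.comp_apply, map_sub, map_zsmul,
      LieHom.map_lie, compactInvolutionFree_H, compactInvolutionFree_E]
    change ⁅(-h a p : KM a), (-f a q : KM a)⁆ - gcm a p q • (-f a q : KM a) = 0
    rw [neg_lie, lie_neg, lie_h_f, smul_neg]
    abel
  · simp only [Relations.HF, Function.uncurry, Function.comp_apply, map_add, map_zsmul,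
      LieHom.map_lie, compactInvolutionFree_H, compactInvolutionFree_F]
    change ⁅(-h a p : KM a), (-e a q : KM a)⁆ + gcm a p q • (-e a q : KM a) = 0
    rw [neg_lie, lie_neg, lie_h_e, smul_neg]
    abel
  · have hy : compactInvolutionFree a ⁅FreeLieAlgebra.of ℂ (Generators.E p),
        FreeLieAlgebra.of ℂ (Generators.E q)⁆ = (⁅f a p, f a q⁆ : KM a) := by
      rw [LieHom.map_lie, compactInvolutionFree_E, compactInvolutionFree_E]
      change ⁅(-f a p : KM a), (-f a q : KM a)⁆ = _
      rw [neg_lie, lie_neg, neg_neg]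
    refine (compactInvolutionFree_ad_pow a _ _ _ _ _ (compactInvolutionFree_E a p) hy).trans ?_
    rw [ad_f_pow]
    exact smul_zero (A := KM a) ((-1 : ℤ) ^ _)
  · have hy : compactInvolutionFree a ⁅FreeLieAlgebra.of ℂ (Generators.F p),
        FreeLieAlgebra.of ℂ (Generators.F q)⁆ = (⁅e a p, e a q⁆ : KM a) := by
      rw [LieHom.map_lie, compactInvolutionFree_F, compactInvolutionFree_F]
      change ⁅(-e a p : KM a), (-e a q : KM a)⁆ = _
      rw [neg_lie, lie_neg, neg_neg]
    refine (compactInvolutionFree_ad_pow a _ _ _ _ _ (compactInvolutionFree_F a p) hy).trans ?_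
    rw [ad_e_pow]
    exact smul_zero (A := KM a) ((-1 : ℤ) ^ _)

theorem compactInvolutionFree_toIdeal (a : ℤ) :
    (Relations.toIdeal ℂ (gcm a)).toSubmodule ≤
      LinearMap.ker (compactInvolutionFree a : _ →ₗ[ℂ] ConjLie (KM a)) := by
  have : Relations.toIdeal ℂ (gcm a) ≤ (compactInvolutionFree a).ker :=
    LieSubmodule.lieSpan_le.2 fun x hx =>
      LieHom.mem_ker.2 (compactInvolutionFree_toSet a hx)
  intro x hx
  exact LieHom.mem_ker.1 (this hx)

/-- The compact involution as a linear map to the conjugate Lie algebra. -/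
def compactInvolutionLin (a : ℤ) : KM a →ₗ[ℂ] ConjLie (KM a) :=
  (Relations.toIdeal ℂ (gcm a)).toSubmodule.liftQ
    (compactInvolutionFree a : _ →ₗ[ℂ] ConjLie (KM a)) (compactInvolutionFree_toIdeal a)

theorem compactInvolutionLin_proj (a : ℤ) (x : FreeLieAlgebra ℂ (Generators (Fin 2))) :
    compactInvolutionLin a (proj a x) = compactInvolutionFree a x := rfl

/-- The compact involution `ω₀`: the antilinear automorphism of the Lie algebra with
`ω₀ (e_p) = -f_p`, `ω₀ (f_p) = -e_p` and `ω₀ (h_p) = -h_p`. -/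
def compactInvolution (a : ℤ) : KM a →ₛₗ[starRingEnd ℂ] KM a where
  toFun x := compactInvolutionLin a x
  map_add' x y := (compactInvolutionLin a).map_add x y
  map_smul' z x := (compactInvolutionLin a).map_smul z x

theorem compactInvolution_lie (a : ℤ) (x y : KM a) :
    compactInvolution a ⁅x, y⁆ = ⁅compactInvolution a x, compactInvolution a y⁆ := by
  obtain ⟨x, rfl⟩ := proj_surjective a x
  obtain ⟨y, rfl⟩ := proj_surjective a y
  rw [← proj_lie]
  exact (compactInvolutionFree a).map_lie x y

theorem compactInvolution_e (a : ℤ) (p : Fin 2) : compactInvolution a (e a p) = -f a p :=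
  compactInvolutionFree_E a p

theorem compactInvolution_f (a : ℤ) (p : Fin 2) : compactInvolution a (f a p) = -e a p :=
  compactInvolutionFree_F a p

theorem compactInvolution_h (a : ℤ) (p : Fin 2) : compactInvolution a (h a p) = -h a p :=
  compactInvolutionFree_H a p

/-! ### Roots -/

/-- The value of `s α₀ + t α₁` on the simple coroot `h_p`. -/
def pairing (a : ℤ) (r : ℤ × ℤ) (p : Fin 2) : ℤ := r.1 * gcm a p 0 + r.2 * gcm a p 1

/-- The root space of `s α₀ + t α₁`, for `r = (s, t)`: the joint eigenspace of the Cartan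
subalgebra. As the Cartan matrix is invertible, different pairs `(s, t)` are different weights. -/
def rootSpace (a : ℤ) (r : ℤ × ℤ) : Submodule ℂ (KM a) where
  carrier := {x | ∀ p, ⁅h a p, x⁆ = pairing a r p • x}
  add_mem' hx hy p := by rw [lie_add, hx p, hy p, smul_add]
  zero_mem' p := by rw [lie_zero, smul_zero]
  smul_mem' z x hx p := by rw [lie_smul, hx p, smul_comm]

/-- `(s, t)` is a root if it is non-zero and `s α₀ + t α₁` has a non-zero root space. -/
def IsRoot (a : ℤ) (r : ℤ × ℤ) : Prop := r ≠ 0 ∧ rootSpace a r ≠ ⊥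

/-- The simple roots `α₀ = (1, 0)` and `α₁ = (0, 1)`. -/
def simpleRoot : Fin 2 → ℤ × ℤ := ![(1, 0), (0, 1)]

/-- The simple reflections `λ ↦ λ - λ(h_p) α_p` of the root lattice. -/
def simpleReflection (a : ℤ) (p : Fin 2) : Equiv.Perm (ℤ × ℤ) :=
  Function.Involutive.toPerm (fun r => r - pairing a r p • simpleRoot p) (by
    rintro ⟨s, t⟩
    fin_cases p <;> simp [pairing, simpleRoot, gcm] <;> ring)

/-- The Weyl group, acting on the root lattice. -/
def weylGroup (a : ℤ) : Subgroup (Equiv.Perm (ℤ × ℤ)) :=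
  Subgroup.closure (Set.range (simpleReflection a))

/-- A real root is a root that is conjugate to a simple root under the Weyl group. -/
def IsRealRoot (a : ℤ) (r : ℤ × ℤ) : Prop :=
  IsRoot a r ∧ ∃ w ∈ weylGroup a, ∃ p, w (simpleRoot p) = r

/-- An imaginary root is a root that is not real. -/
def IsImaginaryRoot (a : ℤ) (r : ℤ × ℤ) : Prop := IsRoot a r ∧ ¬ IsRealRoot a r

/-- `H` is dominant: it lies in the real span of the coroots and `α_p(H) ≥ 0` for both simple
roots. -/
def IsDominant (a : ℤ) (H : KM a) : Prop :=
  ∃ c : Fin 2 → ℝ, H = ∑ p, (c p : ℂ) • h a p ∧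
    ∀ q, 0 ≤ ∑ p, c p * (pairing a (simpleRoot q) p : ℝ)

/-- `F₀ = 0`, `F₁ = 1`, `F_{k+2} = a F_{k+1} - F_k`. -/
def F (a : ℤ) : ℕ → ℤ
  | 0 => 0
  | 1 => 1
  | k + 2 => a * F a (k + 1) - F a k

/-- The real positive root `F_{k+1} α₀ + F_k α₁` of type α. -/
def alphaRoot (a : ℤ) (k : ℕ) : ℤ × ℤ := (F a (k + 1), F a k)

/-- The real positive root `F_k α₀ + F_{k+1} α₁` of type β. -/
def betaRoot (a : ℤ) (k : ℕ) : ℤ × ℤ := (F a k, F a (k + 1))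

/-! ### The regions in the plane and the three types -/

/-- A lattice point as a point of the real plane. -/
def toPlane (r : ℤ × ℤ) : ℝ × ℝ := ((r.1 : ℝ), (r.2 : ℝ))

/-- `f(x, y) = x² - a x y + y²`. -/
def quadForm (a : ℤ) (v : ℝ × ℝ) : ℝ := v.1 ^ 2 - a * v.1 * v.2 + v.2 ^ 2

/-- The region `R`, bounded by the hyperbola `f = 1`. -/
def regionR (a : ℤ) : Set (ℝ × ℝ) := {v | quadForm a v ≤ 1}

/-- The region `L`, for `(k, l) = (F_{i+1}, F_i)`. -/
def regionL (a : ℤ) (i j : ℕ) : Set (ℝ × ℝ) :=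
  {v | 0 ≤ v.1 ∧ 0 ≤ v.2 ∧ v ≠ 0 ∧ quadForm a v ≤ 1 ∧
    (i + 1 = j → v.1 < F a (i + 1)) ∧
    (i = j → v.1 + v.2 < F a (i + 1) + F a i) ∧
    (i = j + 1 → v.2 < F a i)}

/-- Type A, for the two roots `K = (k, l)` and `M = (m, n)` of `X`. -/
def IsTypeA (a : ℤ) (K M r : ℤ × ℤ) : Prop :=
  toPlane (r - K) ∉ regionR a ∧ toPlane (r - M) ∉ regionR a

/-- Type B, for the two roots `K = (k, l)` and `M = (m, n)` of `X`. -/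
def IsTypeB (a : ℤ) (K M r : ℤ × ℤ) : Prop :=
  (toPlane (r - K) ∈ regionR a ∧ toPlane (r + K) ∉ regionR a) ∨
    (toPlane (r - M) ∈ regionR a ∧ toPlane (r + M) ∉ regionR a)

/-- Type C, for the two roots `K = (k, l)` and `M = (m, n)` of `X`. -/
def IsTypeC (a : ℤ) (K M r : ℤ × ℤ) : Prop :=
  (toPlane (r - K) ∈ regionR a ∧ toPlane (r + K) ∈ regionR a) ∨
    (toPlane (r - M) ∈ regionR a ∧ toPlane (r + M) ∈ regionR a)

end KacMoodyRankTwo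

end

/-!
Write `f(s, t) = s² - a s t + t²`, and let `k`, `m` be the two roots of `X`; both have `f = 1`.

The three statements reduce to the values of `f` on roots: `f = 1` on real roots, since `f` is
invariant under the Weyl group, and `f ≤ 0` on imaginary ones
(`IsImaginaryRoot.latticeForm_nonpos`).

* A real root in `L` lies on one of the two positive branches of the hyperbola `f = 1`, and so does
  `k` or `m`, one on each branch. Vectors on the same branch pair positively
  (`latticeForm_sub_le_one_lt_add`), so the root is of type B.
* If `r = k - q` with `q` real, then `f(r - k) = 1` and `f(r + k) = 2 f(r) + 1 ≤ 1`: type C.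
* Let `r` be an imaginary root in `L` that is not of type A, say `f(r - k) ≤ 1`. If `f(r - k) = 1`,
  then `k - r` is a real root (`isRealRoot_of_latticeForm_eq_one`). Otherwise `f(r - k) ≤ 0`; by
  convexity of the cone `f ≤ 0` this is possible only if `r` dominates `k` in both coordinates
  (`one_lt_latticeForm_sub`), which the definition of `L` excludes. That definition bounds `r` only
  if `i` and `j` differ by at most one, and this is where dominance of `H` enters
  (`index_le_of_isDominant`).

The inequality `f ≤ 0` needs the structure of the Lie algebra. The triangular decomposition,
together with an element of the Cartan subalgebra that separates all weights, shows that a root is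
plus or minus a simple root or has two coordinates of the same strict sign
(`isAllowedWeight_of_rootSpace_ne_bot`); in particular proper multiples of simple roots are not
roots. Roots are permuted by the simple reflections, by the theory of `𝔰𝔩₂`-modules
on which the raising operator is locally nilpotent (`IsRoot.simpleReflection`). A root with `f > 0`
can therefore be moved by simple reflections towards `0` until it is simple
(`isConjToSimple_of_descent`), so it is real. The same descent applies to all integral vectors with
`f = 1`; they are roots because the existence of the root vector `E₀` prevents the Chevalley
generators from vanishing (`e_ne_zero`).
-/

noncomputable section

namespace KacMoodyRankTwo

/-! ### Generation by the Chevalley generators -/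

theorem eq_top_of_generators_mem (a : ℤ) (S : LieSubalgebra ℂ (KM a)) (he : ∀ p, e a p ∈ S)
    (hf : ∀ p, f a p ∈ S) (hh : ∀ p, h a p ∈ S) : S = ⊤ := by
  let g : CartanMatrix.Generators (Fin 2) → S
    | .H p => ⟨h a p, hh p⟩
    | .E p => ⟨e a p, he p⟩
    | .F p => ⟨f a p, hf p⟩
  let π : FreeLieAlgebra ℂ (CartanMatrix.Generators (Fin 2)) →ₗ⁅ℂ⁆ KM a :=
    { proj a with map_lie' := fun {x y} => proj_lie a x y }
  have key : S.incl.comp (FreeLieAlgebra.lift ℂ g) = π := by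
    refine FreeLieAlgebra.hom_ext fun x => ?_
    rw [LieHom.comp_apply, FreeLieAlgebra.lift_of_apply]
    cases x <;> rfl
  refine eq_top_iff.2 fun x _ => ?_
  obtain ⟨x, rfl⟩ := proj_surjective a x
  have hx : π x ∈ S := by
    rw [← key]
    exact (FreeLieAlgebra.lift ℂ g x).2
  exact hx

/-- Elements `x₀, x₁, y₀, y₁` that satisfy, up to the sign `ε`, the relations of the Chevalley
generators and generate the algebra together with the Cartan subalgebra. It is used for
`ε = 1`, `x = e`, `y = f` and for `ε = -1`, `x = f`, `y = e`, so that positive and negative roots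
are treated at once. -/
structure IsChevalleySystem (a ε : ℤ) (x y : Fin 2 → KM a) : Prop where
  lie_h_x : ∀ p q, ⁅h a p, x q⁆ = (ε * gcm a p q) • x q
  lie_h_y : ∀ p q, ⁅h a p, y q⁆ = (-(ε * gcm a p q)) • y q
  lie_x_y_self : ∀ p, ⁅x p, y p⁆ = ε • h a p
  lie_x_y_of_ne : ∀ p q, p ≠ q → ⁅x p, y q⁆ = 0
  ad_pow : ∀ p q, ((LieAlgebra.ad ℂ (KM a) (x p)) ^ (-gcm a p q).toNat) ⁅x p, x q⁆ = 0
  eq_top : ∀ S : LieSubalgebra ℂ (KM a), (∀ p, x p ∈ S) → (∀ p, y p ∈ S) →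
    (∀ p, h a p ∈ S) → S = ⊤

theorem isChevalleySystem_e_f (a : ℤ) : IsChevalleySystem a 1 (e a) (f a) where
  lie_h_x p q := by rw [lie_h_e, one_mul]
  lie_h_y p q := by rw [lie_h_f, one_mul, neg_smul]
  lie_x_y_self p := by rw [lie_e_f_self, one_smul]
  lie_x_y_of_ne p q hpq := lie_e_f_of_ne a hpq
  ad_pow := ad_e_pow a
  eq_top := eq_top_of_generators_mem a

theorem isChevalleySystem_f_e (a : ℤ) : IsChevalleySystem a (-1) (f a) (e a) where
  lie_h_x p q := by rw [lie_h_f, neg_one_mul, neg_smul]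
  lie_h_y p q := by rw [lie_h_e, neg_one_mul, neg_neg]
  lie_x_y_self p := by rw [← lie_skew, lie_e_f_self, neg_smul, one_smul]
  lie_x_y_of_ne p q hpq := by rw [← lie_skew, lie_e_f_of_ne a hpq.symm, neg_zero]
  ad_pow := ad_f_pow a
  eq_top S hf he hh := eq_top_of_generators_mem a S he hf hh

/-! ### Root spaces and the triangular decomposition -/

theorem pairing_add (a : ℤ) (r s : ℤ × ℤ) (p : Fin 2) :
    pairing a (r + s) p = pairing a r p + pairing a s p := by
  simp only [pairing, Prod.fst_add, Prod.snd_add]; ring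

theorem pairing_zsmul (a n : ℤ) (r : ℤ × ℤ) (p : Fin 2) :
    pairing a (n • r) p = n * pairing a r p := by
  simp only [pairing, Prod.smul_fst, Prod.smul_snd, smul_eq_mul]; ring

theorem pairing_simpleRoot (a : ℤ) (p q : Fin 2) : pairing a (simpleRoot q) p = gcm a p q := by
  fin_cases q <;> simp [pairing, simpleRoot]

theorem lie_mem_rootSpace {a : ℤ} {r s : ℤ × ℤ} {x y : KM a} (hx : x ∈ rootSpace a r)
    (hy : y ∈ rootSpace a s) : ⁅x, y⁆ ∈ rootSpace a (r + s) := by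
  intro p
  rw [leibniz_lie, hx p, hy p, zsmul_lie, lie_zsmul, pairing_add, add_smul]

theorem h_mem_rootSpace_zero (a : ℤ) (p : Fin 2) : h a p ∈ rootSpace a 0 := by
  intro q
  rw [lie_h_h]
  simp [pairing]

/-- `IsMonomial x z r` says that `z` is an iterated bracket
`[x_{p₁}, [x_{p₂}, …, x_{pₙ}]]` with `r = α_{p₁} + ⋯ + α_{pₙ}`. -/
inductive IsMonomial {a : ℤ} (x : Fin 2 → KM a) : KM a → ℤ × ℤ → Prop
  | gen (p : Fin 2) : IsMonomial x (x p) (simpleRoot p)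
  | lie (p : Fin 2) {z : KM a} {r : ℤ × ℤ} :
      IsMonomial x z r → IsMonomial x ⁅x p, z⁆ (simpleRoot p + r)

/-- The span of all iterated brackets of `x₀` and `x₁`: the nilpotent half of the algebra that
`x` generates. -/
def monomialSpan {a : ℤ} (x : Fin 2 → KM a) : Submodule ℂ (KM a) :=
  Submodule.span ℂ {z | ∃ r, IsMonomial x z r}

/-- The Cartan subalgebra as a subspace. -/
def cartanSpan (a : ℤ) : Submodule ℂ (KM a) := Submodule.span ℂ (Set.range (h a))

theorem IsMonomial.mem_monomialSpan {a : ℤ} {x : Fin 2 → KM a} {z : KM a} {r : ℤ × ℤ}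
    (hz : IsMonomial x z r) : z ∈ monomialSpan x := Submodule.subset_span ⟨r, hz⟩

theorem h_mem_cartanSpan (a : ℤ) (p : Fin 2) : h a p ∈ cartanSpan a :=
  Submodule.subset_span ⟨p, rfl⟩

/-- A linear condition on brackets with `u` can be checked on a spanning set. -/
theorem lie_mem_of_mem_span {a : ℤ} {s : Set (KM a)} {T : Submodule ℂ (KM a)} {u : KM a}
    (hs : ∀ z ∈ s, ⁅u, z⁆ ∈ T) {z : KM a} (hz : z ∈ Submodule.span ℂ s) : ⁅u, z⁆ ∈ T := by
  have : Submodule.span ℂ s ≤ T.comap (LieAlgebra.ad ℂ (KM a) u : KM a →ₗ[ℂ] KM a) :=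
    Submodule.span_le.2 hs
  exact this hz

theorem lie_mem_of_mem_sup {a : ℤ} {S₁ S₂ T : Submodule ℂ (KM a)} {u : KM a}
    (h₁ : ∀ z ∈ S₁, ⁅u, z⁆ ∈ T) (h₂ : ∀ z ∈ S₂, ⁅u, z⁆ ∈ T) {z : KM a} (hz : z ∈ S₁ ⊔ S₂) :
    ⁅u, z⁆ ∈ T := by
  have : S₁ ⊔ S₂ ≤ T.comap (LieAlgebra.ad ℂ (KM a) u : KM a →ₗ[ℂ] KM a) := sup_le h₁ h₂
  exact this hz

namespace IsChevalleySystem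

variable {a ε : ℤ} {x y : Fin 2 → KM a}

theorem x_mem_rootSpace (c : IsChevalleySystem a ε x y) (p : Fin 2) :
    x p ∈ rootSpace a (ε • simpleRoot p) := by
  intro q
  rw [c.lie_h_x, pairing_zsmul, pairing_simpleRoot]

theorem y_mem_rootSpace (c : IsChevalleySystem a ε x y) (p : Fin 2) :
    y p ∈ rootSpace a (-(ε • simpleRoot p)) := by
  intro q
  rw [c.lie_h_y, ← neg_smul, pairing_zsmul, pairing_simpleRoot, neg_mul]

theorem mem_rootSpace_of_isMonomial (c : IsChevalleySystem a ε x y) {z : KM a} {r : ℤ × ℤ}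
    (hz : IsMonomial x z r) : z ∈ rootSpace a (ε • r) := by
  induction hz with
  | gen p => exact c.x_mem_rootSpace p
  | lie p _ ih => rw [smul_add]; exact lie_mem_rootSpace (c.x_mem_rootSpace p) ih

theorem lie_h_mem_monomialSpan (c : IsChevalleySystem a ε x y) (p : Fin 2) {z : KM a}
    (hz : z ∈ monomialSpan x) : ⁅h a p, z⁆ ∈ monomialSpan x := by
  refine lie_mem_of_mem_span ?_ hz
  rintro z ⟨r, hz⟩
  rw [c.mem_rootSpace_of_isMonomial hz p]
  exact zsmul_mem hz.mem_monomialSpan _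

theorem lie_x_mem_monomialSpan (c : IsChevalleySystem a ε x y) (p : Fin 2) {z : KM a}
    (hz : z ∈ monomialSpan x ⊔ cartanSpan a) : ⁅x p, z⁆ ∈ monomialSpan x := by
  refine lie_mem_of_mem_sup (fun z hz => lie_mem_of_mem_span ?_ hz)
    (fun z hz => lie_mem_of_mem_span ?_ hz) hz
  · rintro z ⟨r, hz⟩
    exact (IsMonomial.lie p hz).mem_monomialSpan
  · rintro z ⟨q, rfl⟩
    rw [← lie_skew, c.lie_h_x]
    exact neg_mem (zsmul_mem (IsMonomial.gen p).mem_monomialSpan _)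

theorem lie_y_mem (c : IsChevalleySystem a ε x y) (q : Fin 2) {z : KM a}
    (hz : z ∈ monomialSpan x) : ⁅y q, z⁆ ∈ monomialSpan x ⊔ cartanSpan a := by
  have hyx : ∀ p, ⁅y q, x p⁆ ∈ Submodule.span ℂ {h a p} := by
    intro p
    rw [← lie_skew]
    by_cases hpq : p = q
    · subst hpq
      rw [c.lie_x_y_self]
      exact neg_mem (zsmul_mem (Submodule.mem_span_singleton_self _) _)
    · rw [c.lie_x_y_of_ne p q hpq, neg_zero]
      exact zero_mem _
  refine lie_mem_of_mem_span ?_ hz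
  rintro z ⟨r, hz⟩
  induction hz with
  | gen p =>
    obtain ⟨t, ht⟩ := Submodule.mem_span_singleton.1 (hyx p)
    rw [← ht]
    exact Submodule.mem_sup_right (Submodule.smul_mem _ _ (h_mem_cartanSpan a p))
  | @lie p z r hz ih =>
    obtain ⟨t, ht⟩ := Submodule.mem_span_singleton.1 (hyx p)
    rw [leibniz_lie, ← ht, smul_lie]
    exact Submodule.mem_sup_left (add_mem
      (Submodule.smul_mem _ _ (c.lie_h_mem_monomialSpan p hz.mem_monomialSpan))
      (c.lie_x_mem_monomialSpan p ih))

/-- An iterated bracket of `x₀` and `x₁` is zero or one of `x₀`, `x₁`, unless both generators occur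
in it. This is what excludes the proper multiples of the simple roots as roots. -/
theorem isMonomial_cases {z : KM a} {r : ℤ × ℤ} (hz : IsMonomial x z r) :
    z = 0 ∨ (∃ p, z = x p ∧ r = simpleRoot p) ∨ (0 < r.1 ∧ 0 < r.2) := by
  induction hz with
  | gen p => exact .inr (.inl ⟨p, rfl, rfl⟩)
  | lie p _ ih =>
    rcases ih with rfl | ⟨q, rfl, rfl⟩ | ⟨h1, h2⟩
    · exact .inl (lie_zero _)
    · by_cases hpq : p = q
      · subst hpq
        exact .inl (lie_self _)
      · right; right
        fin_cases p <;> fin_cases q <;> simp_all [simpleRoot]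
    · right; right
      fin_cases p <;> simp [simpleRoot] <;> omega

end IsChevalleySystem

/-- `𝔤 = 𝔫₊ + 𝔥 + 𝔫₋`. -/
theorem triangular_decomposition (a : ℤ) :
    monomialSpan (e a) ⊔ cartanSpan a ⊔ monomialSpan (f a) = ⊤ := by
  set T := monomialSpan (e a) ⊔ cartanSpan a ⊔ monomialSpan (f a) with hT
  have ce := isChevalleySystem_e_f a
  have cf := isChevalleySystem_f_e a
  have leE : monomialSpan (e a) ≤ T := le_sup_left.trans le_sup_left
  have leF : monomialSpan (f a) ≤ T := le_sup_right
  have leH : cartanSpan a ≤ T := le_sup_right.trans le_sup_left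
  have heT : ∀ p, e a p ∈ T := fun p => leE (IsMonomial.gen p).mem_monomialSpan
  have hfT : ∀ p, f a p ∈ T := fun p => leF (IsMonomial.gen p).mem_monomialSpan
  have hhT : ∀ p, h a p ∈ T := fun p => leH (h_mem_cartanSpan a p)
  -- The elements `u` with `[u, T] ⊆ T` form a subalgebra that contains the generators.
  let N : LieSubalgebra ℂ (KM a) :=
    { carrier := {u | ∀ z ∈ T, ⁅u, z⁆ ∈ T}
      add_mem' := fun hu hv z hz => by rw [add_lie]; exact add_mem (hu z hz) (hv z hz)
      zero_mem' := fun z _ => by rw [zero_lie]; exact zero_mem _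
      smul_mem' := fun t u hu z hz => by rw [smul_lie]; exact Submodule.smul_mem _ _ (hu z hz)
      lie_mem' := fun {u v} hu hv z hz => by
        rw [lie_lie]; exact sub_mem (hu _ (hv z hz)) (hv _ (hu z hz)) }
  have hN : N = ⊤ := by
    refine ce.eq_top N (fun p z hz => ?_) (fun p z hz => ?_) (fun p z hz => ?_)
    · refine lie_mem_of_mem_sup (fun z hz => leE (ce.lie_x_mem_monomialSpan p hz))
        (fun z hz => ?_) hz
      exact sup_le leF leH (cf.lie_y_mem p hz)
    · rw [hT, sup_assoc, sup_comm (cartanSpan a)] at hz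
      refine lie_mem_of_mem_sup (fun z hz => ?_)
        (fun z hz => leF (cf.lie_x_mem_monomialSpan p hz)) hz
      exact sup_le leE leH (ce.lie_y_mem p hz)
    · refine lie_mem_of_mem_sup (fun z hz => lie_mem_of_mem_sup
        (fun z hz => leE (ce.lie_h_mem_monomialSpan p hz))
        (fun z hz => lie_mem_of_mem_span ?_ hz) hz)
        (fun z hz => leF (cf.lie_h_mem_monomialSpan p hz)) hz
      rintro z ⟨q, rfl⟩
      rw [lie_h_h]
      exact zero_mem _
  let S : LieSubalgebra ℂ (KM a) :=
    { T with
      lie_mem' := fun {u v} _ hv => by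
        have : u ∈ N := hN ▸ LieSubalgebra.mem_top u
        exact this v hv }
  have hS : S = ⊤ := ce.eq_top S heT hfT hhT
  refine eq_top_iff.2 fun u _ => ?_
  have : u ∈ S := hS ▸ LieSubalgebra.mem_top u
  exact this

/-- The weights that the triangular decomposition permits: zero or, up to sign, a simple root or a
combination of both simple roots with positive coefficients. -/
def IsAllowedWeight (r : ℤ × ℤ) : Prop :=
  r = 0 ∨ (∃ p, r = simpleRoot p ∨ r = -simpleRoot p) ∨ (0 < r.1 ∧ 0 < r.2) ∨ (r.1 < 0 ∧ r.2 < 0)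

/-- A Cartan element on which different weights take different values: it acts on the root space
of `(s, t)` as `(4 - a²) (s + t √-1)`. -/
def regularElement (a : ℤ) : KM a :=
  (2 : ℂ) • h a 0 + (a : ℂ) • h a 1 + Complex.I • ((a : ℂ) • h a 0 + (2 : ℂ) • h a 1)

theorem lie_regularElement {a : ℤ} {r : ℤ × ℤ} {x : KM a} (hx : x ∈ rootSpace a r) :
    ⁅regularElement a, x⁆ = ((4 - a ^ 2) * ((r.1 : ℂ) + r.2 * Complex.I)) • x := by
  simp only [regularElement, add_lie, smul_lie, hx 0, hx 1, ← Int.cast_smul_eq_zsmul ℂ, smul_smul,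
    smul_add, ← add_smul, pairing, gcm]
  congr 1
  simp
  ring

theorem rootSpace_le_eigenspace (a : ℤ) (r : ℤ × ℤ) :
    rootSpace a r ≤ Module.End.eigenspace (LieAlgebra.ad ℂ (KM a) (regularElement a))
      ((4 - a ^ 2) * ((r.1 : ℂ) + r.2 * Complex.I)) := fun _ hx =>
  Module.End.mem_eigenspace_iff.2 (lie_regularElement hx)

theorem regularValue_injective {a : ℤ} (ha : 3 ≤ a) {r s : ℤ × ℤ}
    (hrs : (4 - (a : ℂ) ^ 2) * ((r.1 : ℂ) + r.2 * Complex.I) =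
      (4 - (a : ℂ) ^ 2) * ((s.1 : ℂ) + s.2 * Complex.I)) : r = s := by
  have h4 : (4 - (a : ℂ) ^ 2) ≠ 0 := by
    have : (4 - a ^ 2 : ℤ) ≠ 0 := by nlinarith
    exact_mod_cast this
  have := mul_left_cancel₀ h4 hrs
  have h1 := congrArg Complex.re this
  have h2 := congrArg Complex.im this
  simp at h1 h2
  exact Prod.ext h1 h2

/-- Non-zero vectors of different weights are linearly independent. -/
theorem eq_zero_of_add_eq_zero {a : ℤ} (ha : 3 ≤ a) {r s : ℤ × ℤ} (hrs : r ≠ s) {x y : KM a}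
    (hx : x ∈ rootSpace a r) (hy : y ∈ rootSpace a s) (hxy : x + y = 0) : x = 0 ∧ y = 0 := by
  have hd := (Module.End.eigenspaces_iSupIndep
    (LieAlgebra.ad ℂ (KM a) (regularElement a))).pairwiseDisjoint
    (fun hc => hrs (regularValue_injective ha hc))
  have hx0 : x = 0 := by
    refine Submodule.disjoint_def.1 hd x (rootSpace_le_eigenspace a r hx) ?_
    rw [eq_neg_of_add_eq_zero_left hxy]
    exact neg_mem (rootSpace_le_eigenspace a s hy)
  subst hx0
  exact ⟨rfl, by simpa using hxy⟩

theorem isAllowedWeight_of_rootSpace_ne_bot {a : ℤ} (ha : 3 ≤ a) {r : ℤ × ℤ}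
    (hr : rootSpace a r ≠ ⊥) : IsAllowedWeight r := by
  by_contra hS
  let D := LieAlgebra.ad ℂ (KM a) (regularElement a)
  let v : ℤ × ℤ → ℂ := fun s => (4 - a ^ 2) * ((s.1 : ℂ) + s.2 * Complex.I)
  have hle : ∀ s, IsAllowedWeight s → rootSpace a s ≤ ⨆ c ∈ v '' {s | IsAllowedWeight s},
      Module.End.eigenspace D c := fun s hs =>
    (rootSpace_le_eigenspace a s).trans
      (le_biSup (Module.End.eigenspace D) (Set.mem_image_of_mem v hs))
  have htop : ⨆ c ∈ v '' {s | IsAllowedWeight s}, Module.End.eigenspace D c = ⊤ := by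
    refine eq_top_iff.2 ((triangular_decomposition a).symm.le.trans
      (sup_le (sup_le ?_ ?_) ?_)) <;> refine Submodule.span_le.2 ?_
    · rintro z ⟨s, hz⟩
      have hzs := (isChevalleySystem_e_f a).mem_rootSpace_of_isMonomial hz
      rw [one_smul] at hzs
      rcases IsChevalleySystem.isMonomial_cases hz with rfl | ⟨p, -, rfl⟩ | hpos
      · exact zero_mem _
      · exact hle _ (.inr (.inl ⟨p, .inl rfl⟩)) hzs
      · exact hle _ (.inr (.inr (.inl hpos))) hzs
    · rintro z ⟨p, rfl⟩
      exact hle 0 (.inl rfl) (h_mem_rootSpace_zero a p)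
    · rintro z ⟨s, hz⟩
      have hzs := (isChevalleySystem_f_e a).mem_rootSpace_of_isMonomial hz
      rw [neg_smul, one_smul] at hzs
      rcases IsChevalleySystem.isMonomial_cases hz with rfl | ⟨p, -, rfl⟩ | hpos
      · exact zero_mem _
      · exact hle _ (.inr (.inl ⟨p, .inr rfl⟩)) hzs
      · exact hle _ (.inr (.inr (.inr (by simpa using hpos)))) hzs
  have hv : v r ∉ v '' {s | IsAllowedWeight s} := by
    rintro ⟨s, hs, hsr⟩
    exact hS (regularValue_injective ha hsr ▸ hs)
  have hd := (Module.End.eigenspaces_iSupIndep D).disjoint_biSup hv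
  rw [htop, disjoint_top] at hd
  exact hr (eq_bot_iff.2 (hd ▸ rootSpace_le_eigenspace a r))

/-! ### Weyl group invariance of the roots -/

namespace IsChevalleySystem

variable {a ε : ℤ} {x y : Fin 2 → KM a}

/-- `ad x_p` is locally nilpotent: the elements on which it is nilpotent form a subalgebra, which
contains the generators by the Serre relations. -/
theorem exists_ad_pow_eq_zero (c : IsChevalleySystem a ε x y) (p : Fin 2) (z : KM a) :
    ∃ n : ℕ, ((LieAlgebra.ad ℂ (KM a) (x p)) ^ n) z = 0 := by
  have hx : ∀ q, x q ∈ LieSubalgebra.engel ℂ (x p) := fun q => by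
    refine (LieSubalgebra.mem_engel_iff ℂ _ _).2 ⟨(-gcm a p q).toNat + 1, ?_⟩
    rw [pow_succ, Module.End.mul_apply, LieAlgebra.ad_apply, c.ad_pow]
  have hh : ∀ q, h a q ∈ LieSubalgebra.engel ℂ (x p) := fun q => by
    refine (LieSubalgebra.mem_engel_iff ℂ _ _).2 ⟨2, ?_⟩
    rw [pow_two, Module.End.mul_apply, LieAlgebra.ad_apply, LieAlgebra.ad_apply,
      ← lie_skew (x p) (h a q), c.lie_h_x]
    simp
  have hy : ∀ q, y q ∈ LieSubalgebra.engel ℂ (x p) := fun q => by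
    by_cases hpq : p = q
    · subst hpq
      obtain ⟨n, hn⟩ := (LieSubalgebra.mem_engel_iff ℂ _ _).1 (hh p)
      refine (LieSubalgebra.mem_engel_iff ℂ _ _).2 ⟨n + 1, ?_⟩
      rw [pow_succ, Module.End.mul_apply, LieAlgebra.ad_apply, c.lie_x_y_self, map_zsmul, hn,
        smul_zero]
    · refine (LieSubalgebra.mem_engel_iff ℂ _ _).2 ⟨1, ?_⟩
      rw [pow_one, LieAlgebra.ad_apply, c.lie_x_y_of_ne p q hpq]
  have hz : z ∈ LieSubalgebra.engel ℂ (x p) := c.eq_top _ hx hy hh ▸ LieSubalgebra.mem_top z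
  exact (LieSubalgebra.mem_engel_iff ℂ _ _).1 hz

theorem ad_x_pow_mem_rootSpace (c : IsChevalleySystem a ε x y) (p : Fin 2) {r : ℤ × ℤ} {z : KM a}
    (hz : z ∈ rootSpace a r) (n : ℕ) :
    ((LieAlgebra.ad ℂ (KM a) (x p)) ^ n) z ∈ rootSpace a (r + (n * ε) • simpleRoot p) := by
  induction n with
  | zero => simpa using hz
  | succ n ih =>
    rw [pow_succ', Module.End.mul_apply, LieAlgebra.ad_apply]
    have hr : r + ((n + 1 : ℕ) * ε) • simpleRoot p =
        ε • simpleRoot p + (r + (n * ε) • simpleRoot p) := by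
      push_cast
      module
    rw [hr]
    exact lie_mem_rootSpace (c.x_mem_rootSpace p) ih

theorem ad_y_pow_mem_rootSpace (c : IsChevalleySystem a ε x y) (p : Fin 2) {r : ℤ × ℤ} {z : KM a}
    (hz : z ∈ rootSpace a r) (n : ℕ) :
    ((LieModule.toEnd ℂ (KM a) (KM a) (y p)) ^ n) z ∈
      rootSpace a (r - (n * ε) • simpleRoot p) := by
  induction n with
  | zero => simpa using hz
  | succ n ih =>
    rw [pow_succ', Module.End.mul_apply, LieModule.toEnd_apply_apply]
    have hr : r - ((n + 1 : ℕ) * ε) • simpleRoot p =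
        -(ε • simpleRoot p) + (r - (n * ε) • simpleRoot p) := by
      push_cast
      module
    rw [hr]
    exact lie_mem_rootSpace (c.y_mem_rootSpace p) ih

/-- If `λ(ε h_p) = m ≥ 0`, then `λ - m ε α_p` is a weight along with `λ`: a vector of weight `λ`
is moved by `x_p` to a primitive vector `x_p^b z`, and `y_p^(b + m)` does not kill that. -/
theorem rootSpace_reflection_ne_bot (c : IsChevalleySystem a ε x y) (hε : ε * ε = 1) (p : Fin 2)
    {r : ℤ × ℤ} (hr : rootSpace a r ≠ ⊥) {m : ℕ} (hm : ε * pairing a r p = m) :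
    rootSpace a (r - (m * ε) • simpleRoot p) ≠ ⊥ := by
  rcases Nat.eq_zero_or_pos m with rfl | hm0
  · simpa using hr
  obtain ⟨z, hz, hz0⟩ := (Submodule.ne_bot_iff _).1 hr
  have hgcm : gcm a p p = 2 := by fin_cases p <;> rfl
  have hεhz : ⁅ε • h a p, z⁆ = (m : ℤ) • z := by rw [zsmul_lie, hz p, smul_smul, hm]
  have ht : IsSl2Triple (ε • h a p) (x p) (y p) :=
    { h_ne_zero := fun h0 => by
        rw [h0, zero_lie, natCast_zsmul, ← Nat.cast_smul_eq_nsmul ℂ] at hεhz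
        rcases smul_eq_zero.1 hεhz.symm with h1 | h1
        · exact hm0.ne' (by exact_mod_cast h1)
        · exact hz0 h1
      lie_e_f := c.lie_x_y_self p
      lie_h_e_nsmul := by
        rw [zsmul_lie, c.lie_h_x, smul_smul, hgcm, ← mul_assoc, hε, one_mul]
        exact_mod_cast natCast_zsmul (x p) 2
      lie_h_f_nsmul := by
        rw [zsmul_lie, c.lie_h_y, smul_smul, hgcm, mul_neg, ← mul_assoc, hε, one_mul, neg_smul]
        exact congrArg Neg.neg (by exact_mod_cast natCast_zsmul (y p) 2) }
  obtain ⟨b, hb0, hb1⟩ : ∃ b : ℕ, ((LieAlgebra.ad ℂ (KM a) (x p)) ^ b) z ≠ 0 ∧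
      ((LieAlgebra.ad ℂ (KM a) (x p)) ^ (b + 1)) z = 0 := by
    classical
    have hex := c.exists_ad_pow_eq_zero p z
    have hpos : Nat.find hex ≠ 0 := fun h0 => hz0 (by simpa [h0] using Nat.find_spec hex)
    refine ⟨Nat.find hex - 1, Nat.find_min hex (by omega), ?_⟩
    rw [Nat.sub_add_cancel (Nat.one_le_iff_ne_zero.2 hpos)]
    exact Nat.find_spec hex
  set w := ((LieAlgebra.ad ℂ (KM a) (x p)) ^ b) z with hw
  have hwr := c.ad_x_pow_mem_rootSpace p hz b
  rw [← hw] at hwr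
  have hprim : ht.HasPrimitiveVectorWith w ((m + 2 * b : ℕ) : ℂ) :=
    { ne_zero := hb0
      lie_h := by
        rw [zsmul_lie, hwr p, smul_smul, pairing_add, pairing_zsmul, pairing_simpleRoot, hgcm,
          ← Int.cast_smul_eq_zsmul ℂ]
        congr 1
        have : ε * (pairing a r p + b * ε * 2) = ((m + 2 * b : ℕ) : ℤ) := by
          push_cast
          linear_combination hm + 2 * b * hε
        rw [this, Int.cast_natCast]
      lie_e := by
        rw [pow_succ', Module.End.mul_apply, LieAlgebra.ad_apply] at hb1
        exact hb1 }
  have hne : ∀ k : ℕ, k ≤ m + 2 * b →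
      ((LieModule.toEnd ℂ (KM a) (KM a) (y p)) ^ k) w ≠ 0 := by
    intro k
    induction k with
    | zero => exact fun _ => by simpa using hb0
    | succ k ih =>
      intro hk h0
      have h1 := hprim.lie_e_pow_succ_toEnd_f k
      rw [h0, lie_zero] at h1
      rcases smul_eq_zero.1 h1.symm with h2 | h2
      · rcases mul_eq_zero.1 h2 with h3 | h3
        · exact absurd h3 (by exact_mod_cast Nat.succ_ne_zero k)
        · rw [sub_eq_zero] at h3
          have : m + 2 * b = k := by exact_mod_cast h3
          omega
      · exact ih (by omega) h2
  refine (Submodule.ne_bot_iff _).2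
    ⟨((LieModule.toEnd ℂ (KM a) (KM a) (y p)) ^ (b + m)) w, ?_, hne _ (by omega)⟩
  have hr' : r - (m * ε) • simpleRoot p =
      r + (b * ε) • simpleRoot p - ((b + m : ℕ) * ε) • simpleRoot p := by
    push_cast
    module
  rw [hr']
  exact c.ad_y_pow_mem_rootSpace p hwr (b + m)

end IsChevalleySystem

theorem simpleReflection_apply (a : ℤ) (p : Fin 2) (r : ℤ × ℤ) :
    simpleReflection a p r = r - pairing a r p • simpleRoot p := rfl

theorem simpleReflection_simpleReflection (a : ℤ) (p : Fin 2) (r : ℤ × ℤ) :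
    simpleReflection a p (simpleReflection a p r) = r :=
  (simpleReflection a p).left_inv r

theorem IsRoot.simpleReflection {a : ℤ} {r : ℤ × ℤ} (hr : IsRoot a r) (p : Fin 2) :
    IsRoot a (simpleReflection a p r) := by
  refine ⟨fun h0 => hr.1 ?_, ?_⟩
  · rw [← simpleReflection_simpleReflection a p r, h0]
    simp [simpleReflection_apply, pairing]
  rw [simpleReflection_apply]
  rcases le_total 0 (pairing a r p) with hp | hp
  · have := (isChevalleySystem_e_f a).rootSpace_reflection_ne_bot (by norm_num) p hr.2
      (m := (pairing a r p).toNat) (by rw [Int.toNat_of_nonneg hp, one_mul])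
    rwa [Int.toNat_of_nonneg hp, mul_one] at this
  · have := (isChevalleySystem_f_e a).rootSpace_reflection_ne_bot (by norm_num) p hr.2
      (m := (-pairing a r p).toNat) (by rw [Int.toNat_of_nonneg (by omega), neg_one_mul])
    rwa [Int.toNat_of_nonneg (by omega), neg_mul_neg, mul_one] at this

theorem IsRoot.weylGroup {a : ℤ} {w : Equiv.Perm (ℤ × ℤ)} (hw : w ∈ weylGroup a) :
    ∀ r, IsRoot a r → IsRoot a (w r) := by
  induction hw using Subgroup.closure_induction'' with
  | mem x hx => obtain ⟨p, rfl⟩ := hx; exact fun r hr => hr.simpleReflection p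
  | inv_mem x hx => obtain ⟨p, rfl⟩ := hx; exact fun r hr => hr.simpleReflection p
  | one => exact fun r hr => hr
  | mul x y _ _ hx hy => exact fun r hr => hx _ (hy r hr)

/-! ### The quadratic form on the root lattice -/

/-- The quadratic form `s² - a s t + t²` on the root lattice. -/
def latticeForm (a : ℤ) (r : ℤ × ℤ) : ℤ := r.1 ^ 2 - a * r.1 * r.2 + r.2 ^ 2

theorem toPlane_mem_regionR {a : ℤ} {r : ℤ × ℤ} : toPlane r ∈ regionR a ↔ latticeForm a r ≤ 1 := by
  have : quadForm a (toPlane r) = (latticeForm a r : ℝ) := by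
    simp [quadForm, toPlane, latticeForm]
  rw [regionR, Set.mem_ofPred_eq, this]
  exact_mod_cast Iff.rfl

theorem simpleReflection_zero (a s t : ℤ) : simpleReflection a 0 (s, t) = (a * t - s, t) := by
  ext <;> simp [simpleReflection_apply, pairing, gcm, simpleRoot]
  ring

theorem simpleReflection_one (a s t : ℤ) : simpleReflection a 1 (s, t) = (s, a * s - t) := by
  ext <;> simp [simpleReflection_apply, pairing, gcm, simpleRoot]
  ring

theorem latticeForm_simpleReflection (a : ℤ) (p : Fin 2) (r : ℤ × ℤ) :
    latticeForm a (simpleReflection a p r) = latticeForm a r := by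
  obtain ⟨s, t⟩ := r
  fin_cases p
  · change latticeForm a (simpleReflection a 0 (s, t)) = _
    rw [simpleReflection_zero]; simp only [latticeForm]; ring
  · change latticeForm a (simpleReflection a 1 (s, t)) = _
    rw [simpleReflection_one]; simp only [latticeForm]; ring

theorem latticeForm_weylGroup {a : ℤ} {w : Equiv.Perm (ℤ × ℤ)} (hw : w ∈ weylGroup a) :
    ∀ r, latticeForm a (w r) = latticeForm a r := by
  induction hw using Subgroup.closure_induction'' with
  | mem x hx => obtain ⟨p, rfl⟩ := hx; exact latticeForm_simpleReflection a p
  | inv_mem x hx => obtain ⟨p, rfl⟩ := hx; exact latticeForm_simpleReflection a p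
  | one => exact fun r => rfl
  | mul x y _ _ hx hy => exact fun r => (hx _).trans (hy r)

theorem latticeForm_simpleRoot (a : ℤ) (p : Fin 2) : latticeForm a (simpleRoot p) = 1 := by
  fin_cases p <;> simp [latticeForm, simpleRoot]

theorem IsRealRoot.latticeForm_eq_one {a : ℤ} {r : ℤ × ℤ} (hr : IsRealRoot a r) :
    latticeForm a r = 1 := by
  obtain ⟨-, w, hw, p, rfl⟩ := hr
  rw [latticeForm_weylGroup hw, latticeForm_simpleRoot]

/-- Conjugacy to a simple root under the Weyl group. -/
def IsConjToSimple (a : ℤ) (r : ℤ × ℤ) : Prop := ∃ w ∈ weylGroup a, ∃ p, w (simpleRoot p) = r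

theorem isConjToSimple_simpleRoot (a : ℤ) (p : Fin 2) : IsConjToSimple a (simpleRoot p) :=
  ⟨1, one_mem _, p, rfl⟩

theorem IsConjToSimple.of_simpleReflection {a : ℤ} {r : ℤ × ℤ} {p : Fin 2}
    (hr : IsConjToSimple a (simpleReflection a p r)) : IsConjToSimple a r := by
  obtain ⟨w, hw, q, hq⟩ := hr
  refine ⟨simpleReflection a p * w, mul_mem (Subgroup.subset_closure ⟨p, rfl⟩) hw, q, ?_⟩
  rw [Equiv.Perm.mul_apply, hq, simpleReflection_simpleReflection]

/-- Descent: in a reflection-stable set of non-zero allowed weights on which the form is positive,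
each weight is conjugate to a simple root. If `(s, t)` is not already simple up to sign, then
`2 f(s, t) = s λ(h₀) + t λ(h₁) > 0` yields a simple reflection that brings it closer to `0`. -/
theorem isConjToSimple_of_descent {a : ℤ} (P : ℤ × ℤ → Prop)
    (hrefl : ∀ r p, P r → P (simpleReflection a p r)) (hallowed : ∀ r, P r → IsAllowedWeight r)
    (hpos : ∀ r, P r → 0 < latticeForm a r) {r : ℤ × ℤ} (hr : P r) : IsConjToSimple a r := by
  induction hn : r.1.natAbs + r.2.natAbs using Nat.strong_induction_on generalizing r with
  | _ n ih =>
  obtain ⟨s, t⟩ := r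
  simp only at hn
  have hQ := hpos _ hr
  have h0 := hrefl _ 0 hr
  have h1 := hrefl _ 1 hr
  have hS0 := hallowed _ h0
  have hS1 := hallowed _ h1
  have ih0 := ih ((a * t - s).natAbs + t.natAbs)
  have ih1 := ih (s.natAbs + (a * s - t).natAbs)
  rw [simpleReflection_zero] at h0 hS0
  rw [simpleReflection_one] at h1 hS1
  have r0 : (a * t - s).natAbs < s.natAbs → IsConjToSimple a (s, t) := fun hlt => by
    refine IsConjToSimple.of_simpleReflection (p := 0) ?_
    rw [simpleReflection_zero]
    exact ih0 (by omega) h0 rfl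
  have r1 : (a * s - t).natAbs < t.natAbs → IsConjToSimple a (s, t) := fun hlt => by
    refine IsConjToSimple.of_simpleReflection (p := 1) ?_
    rw [simpleReflection_one]
    exact ih1 (by omega) h1 rfl
  have h2Q : 2 * latticeForm a (s, t) = s * (2 * s - a * t) + t * (2 * t - a * s) := by
    simp only [latticeForm]; ring
  simp only [IsAllowedWeight, Fin.exists_fin_two, simpleRoot, Matrix.cons_val_zero,
    Matrix.cons_val_one, Prod.ext_iff, Prod.fst_neg, Prod.snd_neg, Prod.fst_zero,
    Prod.snd_zero] at hS0 hS1
  rcases hallowed _ hr with h | ⟨p, h | h⟩ | ⟨hs, ht⟩ | ⟨hs, ht⟩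
  · rw [h] at hQ
    simp [latticeForm] at hQ
  · exact h ▸ isConjToSimple_simpleRoot a p
  · refine IsConjToSimple.of_simpleReflection (p := p) ?_
    rw [h, simpleReflection_apply]
    have hgcm : gcm a p p = 2 := by fin_cases p <;> rfl
    convert isConjToSimple_simpleRoot a p using 1
    rw [← neg_one_zsmul, pairing_zsmul, pairing_simpleRoot, hgcm]
    module
  · simp only at hs ht
    by_cases hp : 0 < 2 * s - a * t
    · exact r0 (by omega)
    · have : 0 < 2 * t - a * s := by
        by_contra hq
        nlinarith [mul_nonneg hs.le (not_lt.1 hp |> neg_nonneg.2),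
          mul_nonneg ht.le (not_lt.1 hq |> neg_nonneg.2)]
      exact r1 (by omega)
  · simp only at hs ht
    by_cases hp : 2 * s - a * t < 0
    · exact r0 (by omega)
    · have : 2 * t - a * s < 0 := by
        by_contra hq
        nlinarith [mul_nonneg (neg_nonneg.2 hs.le) (not_lt.1 hp),
          mul_nonneg (neg_nonneg.2 ht.le) (not_lt.1 hq)]
      exact r1 (by omega)

theorem IsImaginaryRoot.latticeForm_nonpos {a : ℤ} (ha : 3 ≤ a) {r : ℤ × ℤ}
    (hr : IsImaginaryRoot a r) : latticeForm a r ≤ 0 := by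
  by_contra hQ
  refine hr.2 ⟨hr.1, isConjToSimple_of_descent (fun r => IsRoot a r ∧ 0 < latticeForm a r)
    (fun r p h => ⟨h.1.simpleReflection p, by rw [latticeForm_simpleReflection]; exact h.2⟩)
    (fun r h => isAllowedWeight_of_rootSpace_ne_bot ha h.1.2) (fun r h => h.2) ⟨hr.1, ?_⟩⟩
  omega

theorem isAllowedWeight_of_latticeForm_eq_one {a : ℤ} (ha : 3 ≤ a) {r : ℤ × ℤ}
    (hr : latticeForm a r = 1) : IsAllowedWeight r := by
  obtain ⟨s, t⟩ := r
  simp only [latticeForm] at hr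
  simp only [IsAllowedWeight, Fin.exists_fin_two, simpleRoot, Matrix.cons_val_zero,
    Matrix.cons_val_one, Prod.ext_iff, Prod.fst_neg, Prod.snd_neg]
  have hsq : ∀ u : ℤ, u ^ 2 = 1 → u = 1 ∨ u = -1 := fun u hu => by
    rcases Int.isUnit_iff.1 (IsUnit.of_pow_eq_one hu two_ne_zero) with h | h <;> simp [h]
  rcases lt_trichotomy s 0 with hs | rfl | hs <;> rcases lt_trichotomy t 0 with ht | rfl | ht
  · exact .inr (.inr (.inr ⟨hs, ht⟩))
  · have := hsq s (by linarith)
    simp; omega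
  · nlinarith [mul_pos (neg_pos.2 hs) ht]
  · have := hsq t (by linarith)
    simp; omega
  · simp at hr
  · have := hsq t (by linarith)
    simp; omega
  · nlinarith [mul_pos hs (neg_pos.2 ht)]
  · have := hsq s (by linarith)
    simp; omega
  · exact .inr (.inr (.inl ⟨hs, ht⟩))

/-- If the root space of a vector of non-zero norm is non-zero, then so are `e₀` and `e₁`: were
`e_p` zero, then so would be `h_p = [e_p, f_p]` and, by `[h_p, e_q] = -a e_q`, all of
the Cartan subalgebra. -/
theorem e_ne_zero {a : ℤ} (ha : 3 ≤ a) {r : ℤ × ℤ} (hr : rootSpace a r ≠ ⊥)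
    (hQ : latticeForm a r ≠ 0) (p : Fin 2) : e a p ≠ 0 := by
  intro hp
  obtain ⟨z, hz, hz0⟩ := (Submodule.ne_bot_iff _).1 hr
  have hh : ∀ q, e a q = 0 → h a q = 0 := fun q hq => by rw [← lie_e_f_self, hq, zero_lie]
  have hpair : ∀ q, pairing a r q = 0 := by
    have hall : ∀ q, h a q = 0 := by
      intro q
      by_cases hpq : p = q
      · exact hpq ▸ hh p hp
      · refine hh q ?_
        have h1 := lie_h_e a p q
        have hg : gcm a p q = -a := by fin_cases p <;> fin_cases q <;> simp_all [gcm]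
        rw [hh p hp, zero_lie, hg, ← Int.cast_smul_eq_zsmul ℂ] at h1
        refine (smul_eq_zero.1 h1.symm).resolve_left ?_
        exact_mod_cast (by omega : -a ≠ 0)
    intro q
    have h1 := hz q
    rw [hall q, zero_lie, ← Int.cast_smul_eq_zsmul ℂ] at h1
    exact_mod_cast (smul_eq_zero.1 h1.symm).resolve_right hz0
  have h0 := hpair 0
  have h1 := hpair 1
  simp [pairing, gcm] at h0 h1
  apply hQ
  simp only [latticeForm]
  have : 2 * (r.1 ^ 2 - a * r.1 * r.2 + r.2 ^ 2) = 0 := by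
    linear_combination r.1 * h0 + r.2 * h1
  omega

/-- Each vector of norm `1` is a real root, as soon as one such vector is known to be a weight. -/
theorem isRealRoot_of_latticeForm_eq_one {a : ℤ} (ha : 3 ≤ a) {r q : ℤ × ℤ}
    (hr : rootSpace a r ≠ ⊥) (hQr : latticeForm a r = 1) (hQ : latticeForm a q = 1) :
    IsRealRoot a q := by
  have hconj : IsConjToSimple a q :=
    isConjToSimple_of_descent (fun r => latticeForm a r = 1)
      (fun r p h => by rw [latticeForm_simpleReflection]; exact h)
      (fun r h => isAllowedWeight_of_latticeForm_eq_one ha h) (fun r h => by omega) hQ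
  obtain ⟨w, hw, p, rfl⟩ := id hconj
  refine ⟨IsRoot.weylGroup hw _ ⟨?_, (Submodule.ne_bot_iff _).2 ⟨e a p, ?_,
    e_ne_zero ha hr (by omega) p⟩⟩, hconj⟩
  · fin_cases p <;> simp [simpleRoot]
  · have := (isChevalleySystem_e_f a).x_mem_rootSpace p
    rwa [one_smul] at this

/-! ### The sequence `F` and the two roots of `X` -/

theorem F_nonneg_and_lt {a : ℤ} (ha : 3 ≤ a) (n : ℕ) : 0 ≤ F a n ∧ F a n < F a (n + 1) := by
  induction n with
  | zero => simp [F]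
  | succ n ih =>
    obtain ⟨h1, h2⟩ := ih
    refine ⟨by omega, ?_⟩
    rw [F]
    nlinarith

theorem F_strictMono {a : ℤ} (ha : 3 ≤ a) : StrictMono (F a) :=
  strictMono_nat_of_lt_succ fun n => (F_nonneg_and_lt ha n).2

theorem latticeForm_alphaRoot (a : ℤ) (i : ℕ) : latticeForm a (alphaRoot a i) = 1 := by
  induction i with
  | zero => simp [latticeForm, alphaRoot, F]
  | succ i ih =>
    rw [← ih]
    simp only [latticeForm, alphaRoot, F]
    ring

theorem latticeForm_swap (a : ℤ) (r : ℤ × ℤ) : latticeForm a r.swap = latticeForm a r := by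
  simp only [latticeForm, Prod.fst_swap, Prod.snd_swap]
  ring

theorem latticeForm_betaRoot (a : ℤ) (j : ℕ) : latticeForm a (betaRoot a j) = 1 :=
  (latticeForm_swap a (alphaRoot a j)).trans (latticeForm_alphaRoot a j)

/-- Two vectors of norm `1` on the branch `s > t ≥ 0` of the hyperbola `f = 1` pair positively, so
that their difference has smaller norm than their sum. -/
theorem latticeForm_sub_le_one_lt_add {a : ℤ} (ha : 3 ≤ a) {r k : ℤ × ℤ} (hr : latticeForm a r = 1)
    (hk : latticeForm a k = 1) (hr0 : 0 ≤ r.2) (hrlt : r.2 < r.1) (hk0 : 0 ≤ k.2)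
    (hklt : k.2 < k.1) : latticeForm a (r - k) ≤ 1 ∧ 1 < latticeForm a (r + k) := by
  obtain ⟨s, t⟩ := r
  obtain ⟨k, l⟩ := k
  simp only [latticeForm, Prod.fst_sub, Prod.snd_sub, Prod.fst_add, Prod.snd_add] at *
  have hbranch : ∀ u v : ℤ, u ^ 2 - a * u * v + v ^ 2 = 1 → 0 ≤ v → v < u → 0 < 2 * u - a * v := by
    intro u v h1 h2 h3
    by_contra h4
    nlinarith [mul_nonneg (sub_nonneg.2 h3.le) (sub_nonneg.2 (not_lt.1 h4)), mul_nonneg h2 h2,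
      mul_nonneg h2 (sub_nonneg.2 h3.le)]
  have hu := hbranch s t hr hr0 hrlt
  have hw := hbranch k l hk hk0 hklt
  -- With `u = 2s - at` and `w = 2k - al`, twice the polar form of the two vectors is
  -- `u w - (a² - 4) t l`, where `u² = 4 + (a² - 4) t²` and `w² = 4 + (a² - 4) l²`.
  have hlt : (a ^ 2 - 4) * (t * l) < (2 * s - a * t) * (2 * k - a * l) := by
    refine lt_of_pow_lt_pow_left₀ 2 (mul_pos hu hw).le ?_
    have e1 : (2 * s - a * t) ^ 2 = 4 + (a ^ 2 - 4) * t ^ 2 := by linear_combination 4 * hr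
    have e2 : (2 * k - a * l) ^ 2 = 4 + (a ^ 2 - 4) * l ^ 2 := by linear_combination 4 * hk
    rw [mul_pow (2 * s - a * t), e1, e2]
    have hD : 0 ≤ a ^ 2 - 4 := by nlinarith
    nlinarith [mul_nonneg hD (sq_nonneg t), mul_nonneg hD (sq_nonneg l)]
  have hB : 0 < 2 * s * k + 2 * t * l - a * (s * l + t * k) := by
    by_contra hB
    nlinarith
  constructor <;> nlinarith

/-- The cone `f ≤ 0` in the first quadrant is closed under addition, so it cannot contain two
vectors whose sum has norm `1`. -/
theorem latticeForm_add_nonpos {a : ℤ} (ha : 3 ≤ a) {r s : ℤ × ℤ} (hr : latticeForm a r ≤ 0)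
    (hs : latticeForm a s ≤ 0) (hr1 : 0 ≤ r.1) (hr2 : 0 ≤ r.2) (hs1 : 0 ≤ s.1) (hs2 : 0 ≤ s.2) :
    latticeForm a (r + s) ≤ 0 := by
  obtain ⟨x, y⟩ := r
  obtain ⟨z, w⟩ := s
  simp only [latticeForm, Prod.fst_add, Prod.snd_add] at *
  -- With `P = xz + yw` and `S = xw + yz`, the hypotheses give `P S ≤ 2a xyzw`, and
  -- `4 xyzw ≤ S²`; hence `2 P ≤ a S`, which says that the polar form is not positive.
  have hxw := mul_nonneg hr1 hs2
  have hyz := mul_nonneg hr2 hs1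
  suffices hPS : 2 * (x * z + y * w) ≤ a * (x * w + y * z) by linarith
  rcases (add_nonneg hxw hyz).eq_or_lt with h0 | h0
  · have hx0 : x * w = 0 := by linarith
    have hy0 : y * z = 0 := by linarith
    have hP : x * z + y * w = 0 := by
      rcases mul_eq_zero.1 hx0 with rfl | rfl
      · have : y = 0 := pow_eq_zero_iff two_ne_zero |>.1 (le_antisymm (by linarith) (sq_nonneg y))
        rw [this]; ring
      · have : z = 0 := pow_eq_zero_iff two_ne_zero |>.1 (le_antisymm (by linarith) (sq_nonneg z))
        rw [this]; ring
    rw [hP, ← h0]; simp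
  · refine le_of_mul_le_mul_right ?_ h0
    have e1 := mul_nonneg (mul_nonneg hs1 hs2) (sub_nonneg.2 hr)
    have e2 := mul_nonneg (mul_nonneg hr1 hr2) (sub_nonneg.2 hs)
    have e3 := mul_nonneg (by linarith : 0 ≤ a) (sq_nonneg (x * w - y * z))
    linarith

theorem same_sign_of_latticeForm_nonpos {a : ℤ} (ha : 3 ≤ a) {r : ℤ × ℤ}
    (hr : latticeForm a r ≤ 0) : (0 ≤ r.1 ∧ 0 ≤ r.2) ∨ (r.1 ≤ 0 ∧ r.2 ≤ 0) := by
  obtain ⟨s, t⟩ := r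
  simp only [latticeForm] at *
  by_contra! h
  have hst : s * t ≤ 0 := by
    rcases le_or_gt 0 s with hs | hs
    · exact mul_nonpos_of_nonneg_of_nonpos hs (h.1 hs).le
    · exact mul_nonpos_of_nonpos_of_nonneg hs.le (h.2 hs.le).le
  have hs0 : s ≠ 0 := by
    rintro rfl
    exact absurd (h.1 le_rfl) (not_lt.2 (h.2 le_rfl).le)
  nlinarith [pow_pos (abs_pos.2 hs0) 2, sq_abs s, sq_nonneg t]

/-- The relation `[H, X] = 2X` forces both roots of `X` to take the value `2` on `H`, and this
determines `H`. Solving for `α₀(H)` and `α₁(H)` shows that `H` is dominant only if `i` and `j` differ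
by at most one. -/
theorem index_le_of_isDominant {a : ℤ} (ha : 3 ≤ a) {i j : ℕ} {E₀ E₁ H : KM a} {c₀ c₁ : ℂ}
    (hE₀ : E₀ ∈ rootSpace a (alphaRoot a i)) (hE₀' : E₀ ≠ 0)
    (hE₁ : E₁ ∈ rootSpace a (betaRoot a j)) (hE₁' : E₁ ≠ 0) (hc₀ : c₀ ≠ 0) (hc₁ : c₁ ≠ 0)
    (hHX : ⁅H, c₀ • E₀ + c₁ • E₁⁆ = 2 • (c₀ • E₀ + c₁ • E₁)) (hH : IsDominant a H) :
    i ≤ j + 1 ∧ j ≤ i + 1 := by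
  obtain ⟨d, rfl, hd⟩ := hH
  have hd0 := hd 0
  have hd1 := hd 1
  obtain ⟨hl0, hlk⟩ := F_nonneg_and_lt ha i
  obtain ⟨hm0, hmn⟩ := F_nonneg_and_lt ha j
  have hact : ∀ {r : ℤ × ℤ} {z : KM a}, z ∈ rootSpace a r →
      ⁅∑ p, (d p : ℂ) • h a p, z⁆ = (∑ p, (d p : ℂ) * (pairing a r p : ℂ)) • z := by
    intro r z hz
    simp only [Fin.sum_univ_two, add_lie, smul_lie, hz 0, hz 1, ← Int.cast_smul_eq_zsmul ℂ,
      smul_smul, add_smul]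
  have hne : alphaRoot a i ≠ betaRoot a j := by
    intro h0
    have h1 := congrArg Prod.fst h0
    have h2 := congrArg Prod.snd h0
    simp only [alphaRoot, betaRoot] at h1 h2
    omega
  rw [lie_add, lie_smul, lie_smul, hact hE₀, hact hE₁, ← Nat.cast_smul_eq_nsmul ℂ] at hHX
  obtain ⟨hx0, hx1⟩ := eq_zero_of_add_eq_zero ha hne
    (x := (c₀ * ((∑ p, (d p : ℂ) * (pairing a (alphaRoot a i) p : ℂ)) - 2)) • E₀)
    (y := (c₁ * ((∑ p, (d p : ℂ) * (pairing a (betaRoot a j) p : ℂ)) - 2)) • E₁)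
    (Submodule.smul_mem _ _ hE₀) (Submodule.smul_mem _ _ hE₁) (by
      rw [← sub_eq_zero] at hHX
      rw [← hHX]
      push_cast
      module)
  have h2a := (mul_eq_zero.1 ((smul_eq_zero.1 hx0).resolve_right hE₀')).resolve_left hc₀
  have h2b := (mul_eq_zero.1 ((smul_eq_zero.1 hx1).resolve_right hE₁')).resolve_left hc₁
  rw [sub_eq_zero] at h2a h2b
  have h2a' : ∑ p, d p * (pairing a (alphaRoot a i) p : ℝ) = 2 := by exact_mod_cast h2a
  have h2b' : ∑ p, d p * (pairing a (betaRoot a j) p : ℝ) = 2 := by exact_mod_cast h2b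
  simp only [Fin.sum_univ_two, pairing, alphaRoot, betaRoot, simpleRoot, Matrix.cons_val_zero,
    Matrix.cons_val_one] at hd0 hd1 h2a' h2b'
  push_cast at hd0 hd1 h2a' h2b'
  set g00 : ℝ := (gcm a 0 0 : ℝ)
  set g01 : ℝ := (gcm a 0 1 : ℝ)
  set g10 : ℝ := (gcm a 1 0 : ℝ)
  set g11 : ℝ := (gcm a 1 1 : ℝ)
  -- `u = α₀(H)` and `v = α₁(H)` satisfy `k u + l v = 2 = m u + n v`.
  obtain ⟨u, hu⟩ : ∃ u, u = d 0 * g00 + d 1 * g10 := ⟨_, rfl⟩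
  obtain ⟨v, hv⟩ : ∃ v, v = d 0 * g01 + d 1 * g11 := ⟨_, rfl⟩
  have hu0 : 0 ≤ u := by rw [hu]; linarith
  have hv0 : 0 ≤ v := by rw [hv]; linarith
  have eK : (F a (i + 1) : ℝ) * u + F a i * v = 2 := by rw [hu, hv]; linarith
  have eM : (F a j : ℝ) * u + F a (j + 1) * v = 2 := by rw [hu, hv]; linarith
  have hl0' : (0 : ℝ) ≤ F a i := by exact_mod_cast hl0
  have hm0' : (0 : ℝ) ≤ F a j := by exact_mod_cast hm0
  have hlk' : (F a i : ℝ) < F a (i + 1) := by exact_mod_cast hlk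
  have hmn' : (F a j : ℝ) < F a (j + 1) := by exact_mod_cast hmn
  have mono := F_strictMono ha
  have huv : 0 < u + v := by
    by_contra h0
    have h1 : u = 0 := by linarith
    have h2 : v = 0 := by linarith
    rw [h1, h2] at eK
    norm_num at eK
  constructor
  · by_contra hij
    -- `n < l < k` makes `k u + l v` exceed `m u + n v`.
    have hlt : (F a (j + 1) : ℝ) < F a i := by exact_mod_cast mono (by omega)
    nlinarith [mul_nonneg hu0 (sub_nonneg.2 hlk'.le), mul_nonneg hu0 (sub_nonneg.2 hmn'.le),
      mul_pos huv (sub_pos.2 hlt)]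
  · by_contra hij
    have hlt : (F a (i + 1) : ℝ) < F a j := by exact_mod_cast mono (by omega)
    nlinarith [mul_nonneg hv0 (sub_nonneg.2 hlk'.le), mul_nonneg hv0 (sub_nonneg.2 hmn'.le),
      mul_pos huv (sub_pos.2 hlt)]

/-! ### The three types -/

/-- Let `f(r) ≤ 0` and `f(k) = 1`, with `r` in the first quadrant. If `f(r - k) ≤ 0`, then `r - k`
lies in the first or in the third quadrant. The first case means that `r` dominates `k`; in the
second, `k = r + (k - r)` is a sum of two vectors of the cone `f ≤ 0` and so lies in it itself. -/
theorem one_lt_latticeForm_sub {a : ℤ} (ha : 3 ≤ a) {r k : ℤ × ℤ} (hr : latticeForm a r ≤ 0)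
    (hr1 : 0 ≤ r.1) (hr2 : 0 ≤ r.2) (hk : latticeForm a k = 1)
    (hne : latticeForm a (r - k) ≠ 1) (hlt : ¬ (k.1 ≤ r.1 ∧ k.2 ≤ r.2)) :
    1 < latticeForm a (r - k) := by
  by_contra hle
  have hQ : latticeForm a (r - k) ≤ 0 := by omega
  rcases same_sign_of_latticeForm_nonpos ha hQ with ⟨h1, h2⟩ | ⟨h1, h2⟩
  · exact hlt ⟨by simpa using h1, by simpa using h2⟩
  · have hneg : latticeForm a (k - r) = latticeForm a (r - k) := by
      simp only [latticeForm, Prod.fst_sub, Prod.snd_sub]; ring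
    have h3 := latticeForm_add_nonpos ha hr (s := k - r) (by omega) hr1 hr2
      (by simpa using h1) (by simpa using h2)
    rw [add_sub_cancel, hk] at h3
    omega

end KacMoodyRankTwo

end

theorem mainTheorem4 (a : ℤ) (ha : 3 ≤ a) (i j : ℕ)
    (E₀ E₁ X Y H : KacMoodyRankTwo.KM a) (c₀ c₁ : ℂ)
    (hE₀ : E₀ ∈ KacMoodyRankTwo.rootSpace a (KacMoodyRankTwo.alphaRoot a i)) (hE₀' : E₀ ≠ 0)
    (hE₁ : E₁ ∈ KacMoodyRankTwo.rootSpace a (KacMoodyRankTwo.betaRoot a j)) (hE₁' : E₁ ≠ 0)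
    (hc₀ : c₀ ≠ 0) (hc₁ : c₁ ≠ 0) (hX : X = c₀ • E₀ + c₁ • E₁)
    (hY : Y = KacMoodyRankTwo.compactInvolution a X) (hs : IsSl2Triple H X Y)
    (hH : KacMoodyRankTwo.IsDominant a H) :
    (∀ r : ℤ × ℤ, KacMoodyRankTwo.IsRealRoot a r →
      KacMoodyRankTwo.toPlane r ∈ KacMoodyRankTwo.regionL a i j →
      KacMoodyRankTwo.IsTypeB a (KacMoodyRankTwo.alphaRoot a i) (KacMoodyRankTwo.betaRoot a j) r) ∧
    (∀ r : ℤ × ℤ, KacMoodyRankTwo.IsImaginaryRoot a r →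
      (∃ q : ℤ × ℤ, KacMoodyRankTwo.IsRealRoot a q ∧
        (r = KacMoodyRankTwo.alphaRoot a i - q ∨ r = KacMoodyRankTwo.betaRoot a j - q)) →
      KacMoodyRankTwo.IsTypeC a (KacMoodyRankTwo.alphaRoot a i) (KacMoodyRankTwo.betaRoot a j) r) ∧
    (∀ r : ℤ × ℤ, KacMoodyRankTwo.IsImaginaryRoot a r →
      KacMoodyRankTwo.toPlane r ∈ KacMoodyRankTwo.regionL a i j →
      (¬ ∃ q : ℤ × ℤ, KacMoodyRankTwo.IsRealRoot a q ∧
        (r = KacMoodyRankTwo.alphaRoot a i - q ∨ r = KacMoodyRankTwo.betaRoot a j - q)) →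
      KacMoodyRankTwo.IsTypeA a (KacMoodyRankTwo.alphaRoot a i)
        (KacMoodyRankTwo.betaRoot a j) r) := by
  open KacMoodyRankTwo in
  have hKne : rootSpace a (alphaRoot a i) ≠ ⊥ := (Submodule.ne_bot_iff _).2 ⟨E₀, hE₀, hE₀'⟩
  obtain ⟨hij, hji⟩ := index_le_of_isDominant ha hE₀ hE₀' hE₁ hE₁' hc₀ hc₁
    (hX ▸ hs.lie_h_e_nsmul) hH
  have hK := latticeForm_alphaRoot a i
  have hM := latticeForm_betaRoot a j
  obtain ⟨hl0, hlk⟩ := F_nonneg_and_lt ha i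
  obtain ⟨hm0, hmn⟩ := F_nonneg_and_lt ha j
  have toInt : ∀ r : ℤ × ℤ, toPlane r ∈ regionL a i j → 0 ≤ r.1 ∧ 0 ≤ r.2 ∧
      (i + 1 = j → r.1 < F a (i + 1)) ∧ (i = j → r.1 + r.2 < F a (i + 1) + F a i) ∧
      (i = j + 1 → r.2 < F a i) := by
    rintro r ⟨h1, h2, -, -, h3, h4, h5⟩
    simp only [toPlane] at h1 h2 h3 h4 h5
    exact ⟨by exact_mod_cast h1, by exact_mod_cast h2, fun h => by exact_mod_cast h3 h,
      fun h => by exact_mod_cast h4 h, fun h => by exact_mod_cast h5 h⟩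
  refine ⟨fun r hr hrL => ?_, fun r hr hq => ?_, fun r hr hrL hq => ?_⟩
  · obtain ⟨h1, h2, -⟩ := toInt r hrL
    have hr1 := hr.latticeForm_eq_one
    simp only [IsTypeB, toPlane_mem_regionR, not_le]
    rcases lt_trichotomy r.1 r.2 with hlt | heq | hgt
    · right
      have := latticeForm_sub_le_one_lt_add ha (r := r.swap) (k := alphaRoot a j)
        ((latticeForm_swap a r).trans hr1) (latticeForm_alphaRoot a j) h1 hlt hm0 hmn
      rwa [← latticeForm_swap a (r - betaRoot a j), ← latticeForm_swap a (r + betaRoot a j)]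
    · -- On the diagonal the form is `(2 - a) s² ≤ 0`.
      exfalso
      simp only [latticeForm, heq] at hr1
      nlinarith [mul_nonneg (sub_nonneg.2 ha) (sq_nonneg r.2), sq_nonneg r.2]
    · left
      exact latticeForm_sub_le_one_lt_add ha hr1 hK h2 hgt hl0 hlk
  · -- If `r = k - q`, then `f(r - k) = f(q) = 1` and, by the parallelogram law,
    -- `f(r + k) = 2 f(r) + 1`.
    have hr0 := hr.latticeForm_nonpos ha
    have key : ∀ k q : ℤ × ℤ, latticeForm a k = 1 → latticeForm a q = 1 → r = k - q →
        latticeForm a (r - k) ≤ 1 ∧ latticeForm a (r + k) ≤ 1 := by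
      rintro k q hk hq rfl
      simp only [latticeForm, Prod.fst_sub, Prod.snd_sub, Prod.fst_add, Prod.snd_add] at *
      constructor <;> nlinarith
    simp only [IsTypeC, toPlane_mem_regionR]
    obtain ⟨q, hq, h1 | h1⟩ := hq
    · exact .inl (key _ _ hK hq.latticeForm_eq_one h1)
    · exact .inr (key _ _ hM hq.latticeForm_eq_one h1)
  · obtain ⟨h1, h2, h3, h4, h5⟩ := toInt r hrL
    have hr0 := hr.latticeForm_nonpos ha
    have hne : ∀ k : ℤ × ℤ, (k = alphaRoot a i ∨ k = betaRoot a j) →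
        latticeForm a (r - k) ≠ 1 := by
      intro k hk h6
      have h7 : latticeForm a (k - r) = 1 := by
        rw [← h6]
        simp only [latticeForm, Prod.fst_sub, Prod.snd_sub]; ring
      refine hq ⟨k - r, isRealRoot_of_latticeForm_eq_one ha hKne hK h7, ?_⟩
      rcases hk with rfl | rfl
      · exact .inl (by abel)
      · exact .inr (by abel)
    simp only [IsTypeA, toPlane_mem_regionR, not_le]
    refine ⟨one_lt_latticeForm_sub ha hr0 h1 h2 hK (hne _ (.inl rfl)) ?_,
      one_lt_latticeForm_sub ha hr0 h1 h2 hM (hne _ (.inr rfl)) ?_⟩ <;>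
    · rintro ⟨h6, h7⟩
      simp only [alphaRoot, betaRoot] at h6 h7
      rcases (by omega : i + 1 = j ∨ i = j ∨ i = j + 1) with rfl | rfl | rfl
      · have := h3 rfl
        omega
      · have := h4 rfl
        omega
      · have := h5 rfl
        omega
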